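/- Let $T$ be the space of all unbounded sets $X\subseteq\mathbb N$, with the topology whose basic open sets are $\langle P,N\rangle=\{X\in T : P\subseteq X \text{ and } N\cap X \text{ is finite}\}$ for $P\subseteq\mathbb N$ finite and $N\subseteq\mathbb N$ arbitrary. The full topological model over $T$ consists of all terms, where a term is (hereditarily) a set of pairs $\langle\sigma,r\rangle$ with $\sigma$ a term and $r$ an open subset of $T$. Each formula $\varphi$ of set theory with terms as parameters has a truth value $[\![\varphi]\!]$ in the complete Heyting algebra $\mathcal O(T)$ of open sets, determined by $$[\![\sigma\in\tau]\!]=\bigvee_{\langle\tau',s\rangle\in\tau}\bigl(s\wedge[\![\sigma=\tau']\!]\bigr),\qquad [\![\sigma=\tau]\!]=\bigwedge_{\langle\sigma',r\rangle\in\sigma}\bigl(r\to[\![\sigma'\in\tau]\!]\bigr)\wedge\bigwedge_{\langle\tau',s\rangle\in\tau}\bigl(s\to[\![\tau'\in\sigma]\!]\bigr),$$ with connectives and quantifiers (ranging over all terms) interpreted by the Heyting algebra operations. An open set $O$ forces $\varphi$, written $O\Vdash\varphi$, if $O\subseteq[\![\varphi]\!]$. A ground model set $x$ has the canonical name $\hat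 x=\{\langle\hat y,T\rangle : y\in x\}$; the natural numbers of the model are $\hat\omega$, and $\hat n$ is written $n$. Let $G$ be the canonical generic, i.e. the term $\{\langle\hat n,\{X\in T: n\in X\}\rangle : n\in\mathbb N\}$. In the model, a set $A\subseteq\hat\omega$ is *bounded* if $\exists N\in\hat\omega\ \forall i\in A\ \, i\le N$, it is *unbounded* if $\forall N\in\hat\omega\ \exists i\in A\ \, i>N$, and it is *sequentially bounded* if every sequence of members of $A$ (every function $a:\hat\omega\to A$) is bounded, i.e. $\exists N\in\hat\omega\ \forall n\in\hat\omega\ \, a_n\le N$. **Theorem.** 1. For every nonempty basic open set $O=\langle P,N\rangle$ and every $n\in\mathbb N$, $O\Vdash n\in G$ if and only if $n\in P$; moreover $T\Vdash G\subseteq\hat\omega$. 2. $T\Vdash G$ is unbounded and sequentially bounded. 3. Consequently the weakening of BD to sequentially bounded sets is refuted: $T\Vdash\neg\,\forall A\subseteq\hat\omega\ (A\text{ sequentially bounded}\to A\text{ bounded})$. -/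

import Mathlib

open TopologicalSpace

universe u v w

/-! ### The full topological model over a space -/

/-- Terms (names) of the full topological model over `T`: a term is a family
`{⟨σ i, r i⟩ | i ∈ I}` of pairs consisting of a term and an open subset of `T`,
hereditarily, where `I` is an arbitrary index set. -/
inductive TopName (T : Type v) [TopologicalSpace T] : Type (max (u + 1) v)
  | mk (I : Type u) (σ : I → TopName T) (r : I → Opens T) : TopName T

namespace TopName

variable {T : Type v} [TopologicalSpace T]

/-- The truth value of `σ = τ`: every member of `σ` is, to the extent to which it is a member,
equal to a member of `τ`, and conversely. -/
def eqVal : TopName.{u} T → TopName.{u} T → Opens T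
  | mk I σ r, mk J τ s =>
    (⨅ i : I, r i ⇨ ⨆ j : J, s j ⊓ eqVal (σ i) (τ j)) ⊓
      (⨅ j : J, s j ⇨ ⨆ i : I, r i ⊓ eqVal (σ i) (τ j))

/-- The truth value of `σ ∈ τ`. -/
def memVal (σ : TopName.{u} T) : TopName.{u} T → Opens T
  | mk J τ s => ⨆ j : J, s j ⊓ eqVal σ (τ j)

/-- The canonical name `x̂ = {⟨ŷ, T⟩ | y ∈ x}` of a ground model set `x`. -/
def hat : PSet.{u} → TopName.{u} T
  | PSet.mk I A => mk I (fun i => hat (A i)) (fun _ => ⊤)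

end TopName

/-! ### Formulas of set theory and their truth values -/

/-- First-order formulas of set theory with parameters from `M`; the bound variable of a
quantifier is represented by a function on `M`. -/
inductive SetFormula (M : Type w) : Type w
  | mem (x y : M) : SetFormula M
  | eq (x y : M) : SetFormula M
  | bot : SetFormula M
  | and (φ ψ : SetFormula M) : SetFormula M
  | or (φ ψ : SetFormula M) : SetFormula M
  | imp (φ ψ : SetFormula M) : SetFormula M
  | all (φ : M → SetFormula M) : SetFormula M
  | ex (φ : M → SetFormula M) : SetFormula M

/-- The truth value of a formula in the full topological model over `T`. -/
def SetFormula.value {T : Type v} [TopologicalSpace T] :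
    SetFormula (TopName.{u} T) → Opens T
  | mem σ τ => TopName.memVal σ τ
  | eq σ τ => TopName.eqVal σ τ
  | bot => ⊥
  | and φ ψ => φ.value ⊓ ψ.value
  | or φ ψ => φ.value ⊔ ψ.value
  | imp φ ψ => φ.value ⇨ ψ.value
  | all φ => ⨅ σ, (φ σ).value
  | ex φ => ⨆ σ, (φ σ).value

/-- `Forces p φ`: the open set `p` forces `φ` in the full topological model. -/
def Forces {T : Type v} [TopologicalSpace T] (p : Opens T)
    (φ : SetFormula (TopName.{u} T)) : Prop :=
  p ≤ φ.value

namespace SetFormula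

variable {M : Type w}

def neg (φ : SetFormula M) : SetFormula M := imp φ bot

def iff (φ ψ : SetFormula M) : SetFormula M := and (imp φ ψ) (imp ψ φ)

/-- `∀ x ∈ A, φ x` -/
def ballIn (A : M) (φ : M → SetFormula M) : SetFormula M := all fun x => imp (mem x A) (φ x)

/-- `∃ x ∈ A, φ x` -/
def bexIn (A : M) (φ : M → SetFormula M) : SetFormula M := ex fun x => and (mem x A) (φ x)

/-- `A ⊆ B` -/
def sub (A B : M) : SetFormula M := ballIn A fun x => mem x B

/-- `z = {x, y}` -/
def isPair (z x y : M) : SetFormula M := all fun w => iff (mem w z) (or (eq w x) (eq w y))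

/-- `z = ⟨x, y⟩ = {{x}, {x, y}}` -/
def isOrdPair (z x y : M) : SetFormula M :=
  ex fun s => ex fun t => and (isPair s x x) (and (isPair t x y) (isPair z s t))

/-- `⟨x, y⟩ ∈ f` -/
def pairMem (f x y : M) : SetFormula M := bexIn f fun z => isOrdPair z x y

/-- `f` is a function from `A` to `B`. -/
def isFun (f A B : M) : SetFormula M :=
  and (ballIn f fun z => bexIn A fun x => bexIn B fun y => isOrdPair z x y)
    (ballIn A fun x => bexIn B fun y =>
      and (pairMem f x y) (all fun y' => imp (pairMem f x y') (eq y' y)))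

/-- `i < n` for von Neumann natural numbers -/
def lt (i n : M) : SetFormula M := mem i n

/-- `i ≤ n` for von Neumann natural numbers -/
def le (i n : M) : SetFormula M := or (mem i n) (eq i n)

/-! In the following formulas the parameter `ω` is the set of natural numbers. -/

/-- The set `A` of natural numbers is bounded. -/
def bounded (ω A : M) : SetFormula M := bexIn ω fun N => ballIn A fun i => le i N

/-- The set `A` of natural numbers is unbounded: `∀ N ∃ i ∈ A, i > N`. -/
def unbounded (ω A : M) : SetFormula M := ballIn ω fun N => bexIn A fun i => lt N i

/-- The sequence `a` of natural numbers is bounded. -/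
def seqIsBounded (ω a : M) : SetFormula M :=
  bexIn ω fun N => ballIn ω fun n => all fun y => imp (pairMem a n y) (le y N)

/-- `A` is sequentially bounded: every sequence of members of `A` is bounded. -/
def sequentiallyBounded (ω A : M) : SetFormula M :=
  all fun a => imp (isFun a ω A) (seqIsBounded ω a)

/-- Every sequentially bounded set of natural numbers is bounded. -/
def weakBD (ω : M) : SetFormula M :=
  all fun A => imp (and (sub A ω) (sequentiallyBounded ω A)) (bounded ω A)

end SetFormula

/-! ### The space of unbounded sets of natural numbers and its generic -/

/-- The unbounded sets of natural numbers. -/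
def UnbddSet : Type := {X : Set ℕ // ¬ BddAbove X}

namespace UnbddSet

/-- The set of all unbounded `X` with `P ⊆ X` and `N ∩ X` finite. -/
def basicSet (P : Finset ℕ) (N : Set ℕ) : Set UnbddSet :=
  {X | (P : Set ℕ) ⊆ X.1 ∧ (N ∩ X.1).Finite}

instance : TopologicalSpace UnbddSet :=
  generateFrom {U | ∃ (P : Finset ℕ) (N : Set ℕ), U = basicSet P N}

theorem basicSet_inter (P Q : Finset ℕ) (N K : Set ℕ) :
    basicSet P N ∩ basicSet Q K = basicSet (P ∪ Q) (N ∪ K) := by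
  ext X
  simp only [basicSet, Set.mem_inter_iff, Set.mem_ofPred_eq, Finset.coe_union,
    Set.union_subset_iff, Set.union_inter_distrib_right, Set.finite_union]
  tauto

theorem isTopologicalBasis_basicSet :
    IsTopologicalBasis {U : Set UnbddSet | ∃ (P : Finset ℕ) (N : Set ℕ), U = basicSet P N} where
  exists_subset_inter := by
    rintro _ ⟨P, N, rfl⟩ _ ⟨Q, K, rfl⟩ X hX
    exact ⟨_, ⟨P ∪ Q, N ∪ K, rfl⟩, basicSet_inter P Q N K ▸ hX,
      (basicSet_inter P Q N K).symm.subset⟩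
  sUnion_eq := by
    refine Set.eq_univ_of_forall fun X => ⟨basicSet ∅ ∅, ⟨∅, ∅, rfl⟩, ?_⟩
    simp [basicSet]
  eq_generateFrom := rfl

/-- The basic open set given by the positive information `P` and the negative information `N`. -/
def basicOpen (P : Finset ℕ) (N : Set ℕ) : Opens UnbddSet :=
  ⟨basicSet P N, isTopologicalBasis_basicSet.isOpen ⟨P, N, rfl⟩⟩

/-- The canonical name of the natural number `n` (a von Neumann numeral). -/
def natName (n : ℕ) : TopName.{u} UnbddSet := TopName.hat (PSet.ofNat n)

/-- The set of natural numbers of the model: the canonical image of the ground model's `ω`. -/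
def omegaName : TopName.{u} UnbddSet := TopName.hat PSet.omega

/-- The canonical generic: the name `{⟨n̂, {X | n ∈ X}⟩ | n ∈ ℕ}`. -/
def genericName : TopName.{u} UnbddSet :=
  TopName.mk (ULift.{u} ℕ) (fun n => natName n.down) (fun n => basicOpen {n.down} ∅)

end UnbddSet

/-! At a point `X` the generic `G` looks like `X` itself, so it is unbounded there. Its sequences
are bounded because basic open sets are connected. If `X` and `Y` lie in `⟨P, N⟩`, so does `X ∪ Y`;
every neighbourhood of `X` contains all finite extensions of `X`, and every neighbourhood of `X ∪ Y`
contains one of them. Hence `X`, `X ∪ Y` and `Y` share a piece of any partition into open sets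
(`basicSet_subset_of_cover`).

If a nonempty `⟨P, N⟩` forces `a : ω → G`, the values that `a n` may take partition it, so a single
`m` is decided. This `m` belongs to every point of `⟨P, N⟩`, hence to `P`, as a number outside `P`
can be deleted from a point (`mem_of_basicSet_subset`). So `max P` bounds the whole sequence. -/

namespace TopName

variable {T : Type v} [TopologicalSpace T]

/-! ### Equality and membership of names -/

theorem le_eqVal_mk {p : Opens T} {I J : Type u} {σ : I → TopName.{u} T} {r : I → Opens T}
    {τ : J → TopName.{u} T} {s : J → Opens T} :
    p ≤ eqVal (mk I σ r) (mk J τ s) ↔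
      (∀ i, ∀ x ∈ p, x ∈ r i → ∃ j, x ∈ s j ∧ x ∈ eqVal (σ i) (τ j)) ∧
        (∀ j, ∀ x ∈ p, x ∈ s j → ∃ i, x ∈ r i ∧ x ∈ eqVal (σ i) (τ j)) := by
  simp only [eqVal, le_inf_iff, le_iInf_iff, le_himp_iff]
  simp only [SetLike.le_def, Opens.mem_inf, Opens.mem_iSup, and_imp]

theorem mem_memVal_mk {x : T} {σ : TopName.{u} T} {J : Type u} {τ : J → TopName.{u} T}
    {s : J → Opens T} : x ∈ memVal σ (mk J τ s) ↔ ∃ j, x ∈ s j ∧ x ∈ eqVal σ (τ j) := by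
  simp only [memVal, Opens.mem_iSup, Opens.mem_inf]

theorem eqVal_refl (σ : TopName.{u} T) : eqVal σ σ = ⊤ := by
  induction σ with
  | mk I σ r ih =>
    refine top_le_iff.1 (le_eqVal_mk.2 ⟨fun i x _ hx => ⟨i, hx, ?_⟩, fun i x _ hx => ⟨i, hx, ?_⟩⟩)
      <;> rw [ih] <;> trivial

theorem mem_eqVal_self (σ : TopName.{u} T) (x : T) : x ∈ eqVal σ σ := by
  rw [eqVal_refl]; trivial

theorem eqVal_comm (σ τ : TopName.{u} T) : eqVal σ τ = eqVal τ σ := by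
  induction σ generalizing τ with
  | mk I σ r ih =>
    cases τ with
    | mk J τ s => simp only [eqVal, ih]; exact inf_comm _ _

theorem eqVal_trans (σ τ ρ : TopName.{u} T) : eqVal σ τ ⊓ eqVal τ ρ ≤ eqVal σ ρ := by
  induction σ generalizing τ ρ with
  | mk I σ r ih =>
    obtain ⟨J, τ, s⟩ := τ
    obtain ⟨K, ρ, t⟩ := ρ
    obtain ⟨h₁, h₂⟩ := le_eqVal_mk.1 (le_refl (eqVal (mk I σ r) (mk J τ s)))
    obtain ⟨h₃, h₄⟩ := le_eqVal_mk.1 (le_refl (eqVal (mk J τ s) (mk K ρ t)))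
    refine le_eqVal_mk.2 ⟨fun i x hx hi => ?_, fun k x hx hk => ?_⟩
    · obtain ⟨j, hj, hij⟩ := h₁ i x hx.1 hi
      obtain ⟨k, hk, hjk⟩ := h₃ j x hx.2 hj
      exact ⟨k, hk, ih i _ _ ⟨hij, hjk⟩⟩
    · obtain ⟨j, hj, hjk⟩ := h₄ k x hx.2 hk
      obtain ⟨i, hi, hij⟩ := h₂ j x hx.1 hj
      exact ⟨i, hi, ih i _ _ ⟨hij, hjk⟩⟩

theorem mem_eqVal_symm {σ τ : TopName.{u} T} {x : T} (h : x ∈ eqVal σ τ) : x ∈ eqVal τ σ :=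
  eqVal_comm σ τ ▸ h

theorem mem_eqVal_trans {σ τ ρ : TopName.{u} T} {x : T} (h : x ∈ eqVal σ τ)
    (h' : x ∈ eqVal τ ρ) : x ∈ eqVal σ ρ :=
  eqVal_trans σ τ ρ ⟨h, h'⟩

theorem mem_memVal_congr_left {σ τ ρ : TopName.{u} T} {x : T} (h : x ∈ eqVal σ τ)
    (h' : x ∈ memVal σ ρ) : x ∈ memVal τ ρ := by
  obtain ⟨K, ρ, t⟩ := ρ
  obtain ⟨k, hk, hx⟩ := mem_memVal_mk.1 h'
  exact mem_memVal_mk.2 ⟨k, hk, mem_eqVal_trans (mem_eqVal_symm h) hx⟩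

theorem mem_memVal_congr_right {σ τ ρ : TopName.{u} T} {x : T} (h : x ∈ eqVal τ ρ)
    (h' : x ∈ memVal σ τ) : x ∈ memVal σ ρ := by
  obtain ⟨J, τ, s⟩ := τ
  obtain ⟨K, ρ, t⟩ := ρ
  obtain ⟨j, hj, hx⟩ := mem_memVal_mk.1 h'
  obtain ⟨k, hk, hjk⟩ := (le_eqVal_mk.1 le_rfl).1 j x h hj
  exact mem_memVal_mk.2 ⟨k, hk, mem_eqVal_trans hx hjk⟩

/-! ### Canonical names of natural numbers -/

theorem mem_memVal_hat_insert {x : T} {σ : TopName.{u} T} {a b : PSet.{u}} :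
    x ∈ memVal σ (hat (insert a b)) ↔ x ∈ eqVal σ (hat a) ∨ x ∈ memVal σ (hat b) := by
  obtain ⟨B, β⟩ := b
  change x ∈ memVal σ (hat (PSet.insert a ⟨B, β⟩)) ↔ _
  simp only [PSet.insert, hat, mem_memVal_mk, Option.exists]
  simp

theorem mem_memVal_hat_ofNat {x : T} {σ : TopName.{u} T} {n : ℕ} :
    x ∈ memVal σ (hat (PSet.ofNat n)) ↔ ∃ m < n, x ∈ eqVal σ (hat (PSet.ofNat m)) := by
  induction n with
  | zero =>
    simp only [PSet.ofNat, not_lt_zero, false_and, exists_false, iff_false]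
    intro h
    obtain ⟨j, -⟩ := mem_memVal_mk.1 h
    exact j.elim
  | succ n ih =>
    rw [PSet.ofNat, mem_memVal_hat_insert, ih]
    simp only [Nat.lt_succ_iff_lt_or_eq, or_and_right, exists_or, exists_eq_left]
    exact or_comm

theorem mem_memVal_hat_omega {x : T} {σ : TopName.{u} T} :
    x ∈ memVal σ (hat PSet.omega) ↔ ∃ n : ℕ, x ∈ eqVal σ (hat (PSet.ofNat n)) := by
  simp only [PSet.omega, hat, mem_memVal_mk, ULift.exists]
  simp

theorem mem_memVal_hat_ofNat_of_lt {m n : ℕ} (h : m < n) (x : T) :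
    x ∈ memVal (hat.{u} (PSet.ofNat m)) (hat (PSet.ofNat n)) :=
  mem_memVal_hat_ofNat.2 ⟨m, h, mem_eqVal_self _ x⟩

/-- If the two numerals agreed at `x`, then `m` would be a member of itself there, hence equal to
some `k < m`; this descends. -/
theorem notMem_eqVal_hat_ofNat_of_lt {m n : ℕ} (h : m < n) (x : T) :
    x ∉ eqVal (hat.{u} (PSet.ofNat m)) (hat (PSet.ofNat n)) := by
  induction m using Nat.strong_induction_on generalizing n with
  | _ m ih =>
    intro hx
    obtain ⟨k, hk, hxk⟩ := mem_memVal_hat_ofNat.1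
      (mem_memVal_congr_right (mem_eqVal_symm hx) (mem_memVal_hat_ofNat_of_lt h x))
    exact ih k hk hk (mem_eqVal_symm hxk)

theorem mem_eqVal_hat_ofNat {m n : ℕ} {x : T} :
    x ∈ eqVal (hat.{u} (PSet.ofNat m)) (hat (PSet.ofNat n)) ↔ m = n := by
  refine ⟨fun h => ?_, fun h => h ▸ mem_eqVal_self _ x⟩
  rcases lt_trichotomy m n with hlt | heq | hgt
  · exact absurd h (notMem_eqVal_hat_ofNat_of_lt hlt x)
  · exact heq
  · exact absurd (mem_eqVal_symm h) (notMem_eqVal_hat_ofNat_of_lt hgt x)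

theorem mem_memVal_hat_ofNat_ofNat {m n : ℕ} {x : T} :
    x ∈ memVal (hat.{u} (PSet.ofNat m)) (hat (PSet.ofNat n)) ↔ m < n := by
  simp [mem_memVal_hat_ofNat, mem_eqVal_hat_ofNat]

end TopName

/-! ### Forcing of compound formulas -/

namespace SetFormula

open TopName

variable {T : Type v} [TopologicalSpace T]

/-- A Heyting implication at a point is a condition on a whole neighbourhood. Introduction rules for
`imp` and `all` are therefore stated for open sets, while elimination works pointwise. -/
theorem le_value_imp {p : Opens T} {φ ψ : SetFormula (TopName.{u} T)} :
    p ≤ (imp φ ψ).value ↔ ∀ x ∈ p, x ∈ φ.value → x ∈ ψ.value := by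
  simp only [value, le_himp_iff]
  exact ⟨fun h x hp hx => h ⟨hp, hx⟩, fun h x hx => h x hx.1 hx.2⟩

theorem le_value_all {p : Opens T} {φ : TopName.{u} T → SetFormula (TopName.{u} T)} :
    p ≤ (all φ).value ↔ ∀ σ, p ≤ (φ σ).value :=
  le_iInf_iff

theorem le_value_ballIn {p : Opens T} {A : TopName.{u} T}
    {φ : TopName.{u} T → SetFormula (TopName.{u} T)} :
    p ≤ (ballIn A φ).value ↔ ∀ σ, ∀ x ∈ p, x ∈ memVal σ A → x ∈ (φ σ).value := by
  simp only [ballIn, le_value_all, le_value_imp]; rfl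

theorem mem_value_imp {x : T} {φ ψ : SetFormula (TopName.{u} T)} (h : x ∈ (imp φ ψ).value)
    (hφ : x ∈ φ.value) : x ∈ ψ.value :=
  le_value_imp.1 le_rfl x h hφ

theorem mem_value_all {x : T} {φ : TopName.{u} T → SetFormula (TopName.{u} T)}
    (h : x ∈ (all φ).value) (σ : TopName.{u} T) : x ∈ (φ σ).value :=
  le_value_all.1 le_rfl σ h

theorem mem_value_ballIn {x : T} {A : TopName.{u} T}
    {φ : TopName.{u} T → SetFormula (TopName.{u} T)} (h : x ∈ (ballIn A φ).value)
    {σ : TopName.{u} T} (hσ : x ∈ memVal σ A) : x ∈ (φ σ).value :=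
  le_value_ballIn.1 le_rfl σ x h hσ

theorem mem_value_ex {x : T} {φ : TopName.{u} T → SetFormula (TopName.{u} T)} :
    x ∈ (ex φ).value ↔ ∃ σ, x ∈ (φ σ).value := by
  simp only [value, Opens.mem_iSup]

theorem mem_value_bexIn {x : T} {A : TopName.{u} T}
    {φ : TopName.{u} T → SetFormula (TopName.{u} T)} :
    x ∈ (bexIn A φ).value ↔ ∃ σ, x ∈ memVal σ A ∧ x ∈ (φ σ).value :=
  mem_value_ex

theorem mem_value_le {x : T} {σ τ : TopName.{u} T} :
    x ∈ (le σ τ).value ↔ x ∈ memVal σ τ ∨ x ∈ eqVal σ τ :=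
  Iff.rfl

theorem mem_value_isPair_congr {x : T} {z a a' b b' : TopName.{u} T} (ha : x ∈ eqVal a a')
    (hb : x ∈ eqVal b b') (h : x ∈ (isPair z a b).value) : x ∈ (isPair z a' b').value := by
  -- `isPair` is a universal statement about implications, so the hypotheses are first turned into
  -- an open neighbourhood of `x`.
  suffices H : eqVal a a' ⊓ eqVal b b' ⊓ (isPair z a b).value ≤ (isPair z a' b').value from
    H ⟨⟨ha, hb⟩, h⟩
  refine le_value_all.2 fun w => le_inf (le_value_imp.2 ?_) (le_value_imp.2 ?_)
  · rintro y ⟨⟨hya, hyb⟩, hy⟩ hw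
    exact (mem_value_imp (mem_value_all hy w).1 hw).imp
      (fun h => mem_eqVal_trans h hya) fun h => mem_eqVal_trans h hyb
  · rintro y ⟨⟨hya, hyb⟩, hy⟩ hw
    exact mem_value_imp (mem_value_all hy w).2 (hw.imp
      (fun h => mem_eqVal_trans h (mem_eqVal_symm hya))
      fun h => mem_eqVal_trans h (mem_eqVal_symm hyb))

theorem mem_value_pairMem_congr {x : T} {f a a' b : TopName.{u} T} (ha : x ∈ eqVal a a')
    (h : x ∈ (pairMem f a b).value) : x ∈ (pairMem f a' b).value := by
  obtain ⟨z, hz, h⟩ := mem_value_bexIn.1 h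
  obtain ⟨s, h⟩ := mem_value_ex.1 h
  obtain ⟨t, hs, ht, hst⟩ := mem_value_ex.1 h
  exact mem_value_bexIn.2 ⟨z, hz, mem_value_ex.2 ⟨s, mem_value_ex.2 ⟨t,
    mem_value_isPair_congr ha ha hs, mem_value_isPair_congr ha (mem_eqVal_self b x) ht, hst⟩⟩⟩

end SetFormula

/-! ### Topology of the space of unbounded sets -/

namespace UnbddSet

open TopName SetFormula

theorem mem_basicOpen_singleton {X : UnbddSet} {n : ℕ} : X ∈ basicOpen {n} ∅ ↔ n ∈ X.1 := by
  change X ∈ basicSet {n} ∅ ↔ _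
  simp [basicSet]

/-- The union of an unbounded set with a set of natural numbers. -/
def union (X : UnbddSet) (Y : Set ℕ) : UnbddSet :=
  ⟨X.1 ∪ Y, fun h => X.2 (h.mono Set.subset_union_left)⟩

/-- Adding finitely many elements to an unbounded set stays in every neighbourhood of it. -/
theorem union_finite_mem {X : UnbddSet} {Y : Set ℕ} (hY : Y.Finite) {U : Opens UnbddSet}
    (hX : X ∈ U) : X.union Y ∈ U := by
  obtain ⟨_, ⟨P, N, rfl⟩, ⟨hP, hN⟩, hU⟩ :=
    isTopologicalBasis_basicSet.exists_subset_of_mem_open hX U.isOpen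
  refine hU ⟨hP.trans Set.subset_union_left, ?_⟩
  change (N ∩ (X.1 ∪ Y)).Finite
  rw [Set.inter_union_distrib_left]
  exact hN.union (hY.subset Set.inter_subset_right)

/-- Negative information only asks for finite intersections, and these survive finite unions. -/
theorem union_mem_basicSet {P : Finset ℕ} {N : Set ℕ} {X Y : UnbddSet} (hX : X ∈ basicSet P N)
    (hY : Y ∈ basicSet P N) : X.union Y.1 ∈ basicSet P N := by
  refine ⟨hX.1.trans Set.subset_union_left, ?_⟩
  change (N ∩ (X.1 ∪ Y.1)).Finite
  rw [Set.inter_union_distrib_left]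
  exact hX.2.union hY.2

/-- Every neighbourhood of `X ∪ Y` contains a finite extension of `X`. -/
theorem exists_finite_union_mem {X : UnbddSet} {Y : Set ℕ} {U : Opens UnbddSet}
    (hU : X.union Y ∈ U) : ∃ Q : Set ℕ, Q.Finite ∧ X.union Q ∈ U := by
  obtain ⟨_, ⟨Q, K, rfl⟩, ⟨-, hK⟩, hQU⟩ :=
    isTopologicalBasis_basicSet.exists_subset_of_mem_open hU U.isOpen
  -- The positive part `Q` of a basic neighbourhood suffices: `K` meets `X` finitely because it
  -- meets `X ∪ Y` finitely.
  refine ⟨Q, Q.finite_toSet, hQU ⟨Set.subset_union_right, ?_⟩⟩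
  change (K ∩ (X.1 ∪ (Q : Set ℕ))).Finite
  rw [Set.inter_union_distrib_left]
  exact (hK.subset (Set.inter_subset_inter_right _ Set.subset_union_left)).union
    (Q.finite_toSet.inter_of_right K)

/-- A partition of a basic open set into disjoint open sets is trivial. -/
theorem basicSet_subset_of_cover {ι : Type*} {P : Finset ℕ} {N : Set ℕ}
    {W : ι → Opens UnbddSet} (hcov : ∀ X ∈ basicSet P N, ∃ i, X ∈ W i)
    (hdisj : ∀ i j X, X ∈ W i → X ∈ W j → i = j) {X Y : UnbddSet} (hX : X ∈ basicSet P N)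
    (hY : Y ∈ basicSet P N) {i : ι} (hi : X ∈ W i) : Y ∈ W i := by
  -- Some finite extension of `A` lies in `W k`, and it also lies in `W j` with `A`; disjointness
  -- identifies the pieces.
  have key : ∀ {A B : UnbddSet} {j k : ι}, A ∈ W j → A.union B.1 ∈ W k → j = k := by
    intro A B j k hA hAB
    obtain ⟨Q, hQ, hAQ⟩ := exists_finite_union_mem hAB
    exact hdisj _ _ _ (union_finite_mem hQ hA) hAQ
  obtain ⟨j, hj⟩ := hcov Y hY
  obtain ⟨k, hk⟩ := hcov _ (union_mem_basicSet hX hY)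
  have hk' : Y.union X.1 ∈ W k := by
    have : Y.union X.1 = X.union Y.1 := Subtype.ext (Set.union_comm _ _)
    rwa [this]
  rwa [key hi hk, ← key hj hk']

/-- Deleting a number outside `P` from a point leaves an unbounded set that still satisfies both
conditions. -/
theorem mem_of_basicSet_subset {P : Finset ℕ} {N : Set ℕ} {n : ℕ}
    (hne : (basicSet P N).Nonempty) (h : ∀ X ∈ basicSet P N, n ∈ X.1) : n ∈ P := by
  by_contra hn
  obtain ⟨X, hP, hN⟩ := hne
  refine absurd (h ⟨X.1 \ {n}, fun hb => X.2 ?_⟩ ⟨?_, ?_⟩) fun h => h.2 rfl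
  · exact ((hb.union (bddAbove_singleton (a := n))).mono fun x hx => by
      by_cases hxn : x = n <;> simp [hxn, hx])
  · exact fun x hx => ⟨hP hx, fun hxn => hn (by simpa [← Set.mem_singleton_iff.1 hxn] using hx)⟩
  · exact hN.subset (Set.inter_subset_inter_right _ Set.sdiff_subset)

/-! ### The generic and its sequences -/

theorem exists_gt_mem (X : UnbddSet) (n : ℕ) : ∃ m ∈ X.1, n < m :=
  not_bddAbove_iff.1 X.2 n

theorem mem_memVal_genericName {X : UnbddSet} {σ : TopName.{u} UnbddSet} :
    X ∈ memVal σ genericName ↔ ∃ n ∈ X.1, X ∈ eqVal σ (natName n) := by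
  simp only [genericName, mem_memVal_mk, ULift.exists, mem_basicOpen_singleton]

theorem mem_memVal_natName_genericName {X : UnbddSet} {n : ℕ} :
    X ∈ memVal (natName.{u} n) genericName ↔ n ∈ X.1 := by
  simp [mem_memVal_genericName, natName, mem_eqVal_hat_ofNat]

theorem mem_memVal_omegaName {X : UnbddSet} {σ : TopName.{u} UnbddSet} :
    X ∈ memVal σ omegaName ↔ ∃ n, X ∈ eqVal σ (natName n) :=
  mem_memVal_hat_omega

theorem natName_mem_omegaName (X : UnbddSet) (n : ℕ) :
    X ∈ memVal (natName.{u} n) omegaName :=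
  mem_memVal_omegaName.2 ⟨n, mem_eqVal_self _ X⟩

theorem forces_natName_mem_genericName_iff {P : Finset ℕ} {N : Set ℕ} {n : ℕ}
    (hne : (basicSet P N).Nonempty) :
    Forces (basicOpen P N) (mem (natName.{u} n) genericName) ↔ n ∈ P :=
  ⟨fun h => mem_of_basicSet_subset hne fun _ hX => mem_memVal_natName_genericName.1 (h hX),
    fun hn _ hX => mem_memVal_natName_genericName.2 (hX.1 hn)⟩

theorem forces_genericName_sub_omegaName :
    Forces ⊤ (sub genericName.{u} omegaName) :=
  le_value_ballIn.2 fun _ _ _ hσ =>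
    have ⟨n, _, hn⟩ := mem_memVal_genericName.1 hσ
    mem_memVal_omegaName.2 ⟨n, hn⟩

theorem forces_unbounded_genericName :
    Forces ⊤ (unbounded omegaName.{u} genericName) := by
  refine le_value_ballIn.2 fun σ X _ hσ => ?_
  obtain ⟨n, hn⟩ := mem_memVal_omegaName.1 hσ
  obtain ⟨m, hm, hnm⟩ := X.exists_gt_mem n
  exact mem_value_bexIn.2 ⟨natName m, mem_memVal_natName_genericName.2 hm,
    mem_memVal_congr_left (mem_eqVal_symm hn) (mem_memVal_hat_ofNat_of_lt hnm X)⟩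

/-- The truth value of the statement that `m ∈ G` is the unique value of `a` at `n`. -/
def valueAt (a : TopName.{u} UnbddSet) (n m : ℕ) : Opens UnbddSet :=
  (SetFormula.and (mem (natName m) genericName)
    (ex fun y => SetFormula.and (eq y (natName m)) (SetFormula.and (pairMem a (natName n) y)
      (all fun y' => imp (pairMem a (natName n) y') (eq y' y))))).value

theorem mem_eqVal_of_mem_valueAt {a : TopName.{u} UnbddSet} {n m : ℕ} {X : UnbddSet}
    (h : X ∈ valueAt a n m) {y : TopName.{u} UnbddSet}
    (hy : X ∈ (pairMem a (natName n) y).value) : X ∈ eqVal y (natName m) := by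
  obtain ⟨z, hz, -, hu⟩ := mem_value_ex.1 h.2
  exact mem_eqVal_trans (mem_value_imp (mem_value_all hu y) hy) hz

theorem valueAt_unique {a : TopName.{u} UnbddSet} {n m k : ℕ} {X : UnbddSet}
    (hm : X ∈ valueAt a n m) (hk : X ∈ valueAt a n k) : m = k := by
  obtain ⟨z, hz, hp, -⟩ := mem_value_ex.1 hm.2
  exact mem_eqVal_hat_ofNat.1
    (mem_eqVal_trans (mem_eqVal_symm hz) (mem_eqVal_of_mem_valueAt hk hp))

/-- The value `y` supplied by `isFun` lies in `G`, so at `X` it equals a numeral in `X`. Keeping `y`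
as the witness avoids substituting the numeral into `pairMem`. -/
theorem exists_mem_valueAt {a : TopName.{u} UnbddSet} {X : UnbddSet}
    (h : X ∈ (isFun a omegaName genericName).value) (n : ℕ) : ∃ m, X ∈ valueAt a n m := by
  obtain ⟨y, hy, hv⟩ := mem_value_bexIn.1 (mem_value_ballIn h.2 (natName_mem_omegaName X n))
  obtain ⟨m, hm, hym⟩ := mem_memVal_genericName.1 hy
  exact ⟨m, mem_memVal_natName_genericName.2 hm, mem_value_ex.2 ⟨y, hym, hv⟩⟩

/-- A basic open set forcing `a : ω → G` decides all values of `a`, and they lie in its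
positive part. -/
theorem exists_mem_forall_mem_valueAt {a : TopName.{u} UnbddSet} {P : Finset ℕ} {N : Set ℕ}
    (hne : (basicSet P N).Nonempty)
    (h : Forces (basicOpen P N) (isFun a omegaName genericName)) (n : ℕ) :
    ∃ m ∈ P, ∀ X ∈ basicSet P N, X ∈ valueAt a n m := by
  obtain ⟨X, hX⟩ := hne
  obtain ⟨m, hm⟩ := exists_mem_valueAt (h hX) n
  have hall : ∀ Y ∈ basicSet P N, Y ∈ valueAt a n m := fun Y hY =>
    basicSet_subset_of_cover (fun Z hZ => exists_mem_valueAt (h hZ) n)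
      (fun _ _ _ => valueAt_unique) hX hY hm
  exact ⟨m, mem_of_basicSet_subset ⟨X, hX⟩ fun Y hY =>
    mem_memVal_natName_genericName.1 (hall Y hY).1, hall⟩

theorem mem_value_le_natName {X : UnbddSet} {y : TopName.{u} UnbddSet} {m M : ℕ} (h : m ≤ M)
    (hy : X ∈ eqVal y (natName m)) : X ∈ (le y (natName M)).value := by
  rcases h.lt_or_eq with h | rfl
  · exact Or.inl (mem_memVal_congr_left (mem_eqVal_symm hy) (mem_memVal_hat_ofNat_of_lt h X))
  · exact Or.inr hy

theorem forces_sequentiallyBounded_genericName :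
    Forces ⊤ (sequentiallyBounded omegaName.{u} genericName) := by
  refine le_value_all.2 fun a => le_value_imp.2 fun X _ hX => ?_
  obtain ⟨_, ⟨P, N, rfl⟩, hXP, hPN⟩ :=
    isTopologicalBasis_basicSet.exists_subset_of_mem_open hX (Opens.isOpen _)
  -- The bound is `max P`. The default value 0 for empty `P` is harmless: no nonempty `⟨∅, N⟩`
  -- forces a function into `G`.
  refine mem_value_bexIn.2 ⟨natName (P.sup id), natName_mem_omegaName X _, ?_⟩
  -- The bound has to be verified on all of `⟨P, N⟩`, not only at `X`, since the claim consists of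
  -- nested implications.
  suffices H : basicOpen P N ≤ (ballIn omegaName fun n => all fun y =>
      imp (pairMem a n y) (le y (natName (P.sup id)))).value from H hXP
  refine le_value_all.2 fun σ => le_value_imp.2 ?_
  suffices H : basicOpen P N ⊓ memVal σ omegaName ≤ (all fun y =>
      imp (pairMem a σ y) (le y (natName (P.sup id)))).value from fun Y hY hσ => H ⟨hY, hσ⟩
  refine le_value_all.2 fun y => le_value_imp.2 ?_
  rintro Y ⟨hY, hσ⟩ hp
  obtain ⟨n, hn⟩ := mem_memVal_omegaName.1 hσ
  obtain ⟨m, hm, hall⟩ := exists_mem_forall_mem_valueAt ⟨X, hXP⟩ hPN n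
  exact mem_value_le_natName (Finset.le_sup (f := id) hm)
    (mem_eqVal_of_mem_valueAt (hall Y hY) (mem_value_pairMem_congr hn hp))

/-- At `X` a bound would be a numeral `n`, but `X` has an element above `n`. As this excludes every
point, the negation is forced everywhere. -/
theorem notMem_value_bounded_genericName (X : UnbddSet) :
    X ∉ (bounded omegaName.{u} genericName).value := by
  intro h
  obtain ⟨σ, hσ, hb⟩ := mem_value_bexIn.1 h
  obtain ⟨n, hn⟩ := mem_memVal_omegaName.1 hσ
  obtain ⟨m, hm, hnm⟩ := X.exists_gt_mem n
  rcases mem_value_le.1 (mem_value_ballIn hb (mem_memVal_natName_genericName.2 hm)) with h | h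
  · exact hnm.not_gt (mem_memVal_hat_ofNat_ofNat.1 (mem_memVal_congr_right hn h))
  · exact hnm.ne' (mem_eqVal_hat_ofNat.1 (mem_eqVal_trans h hn))

theorem forces_neg_weakBD : Forces ⊤ (neg (weakBD omegaName.{u})) := by
  refine le_value_imp.2 fun X _ hX => absurd ?_ (notMem_value_bounded_genericName.{u} X)
  exact mem_value_imp (mem_value_all hX genericName) ⟨forces_genericName_sub_omegaName trivial,
    forces_sequentiallyBounded_genericName trivial⟩

end UnbddSet

theorem mainTheorem3 :
    -- the canonical generic: a nonempty basic open set forces `n ∈ G` iff `n` belongs to its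
    -- positive part
    (∀ (P : Finset ℕ) (N : Set ℕ) (n : ℕ), (UnbddSet.basicSet P N).Nonempty →
      (Forces (UnbddSet.basicOpen P N)
        (SetFormula.mem (UnbddSet.natName.{u} n) UnbddSet.genericName.{u}) ↔ n ∈ P)) ∧
    -- `T ⊩ G ⊆ ω`
    Forces ⊤ (SetFormula.sub UnbddSet.genericName.{u} UnbddSet.omegaName.{u}) ∧
    -- `T ⊩ G is unbounded`
    Forces ⊤ (SetFormula.unbounded UnbddSet.omegaName.{u} UnbddSet.genericName.{u}) ∧
    -- `T ⊩ G is sequentially bounded`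
    Forces ⊤ (SetFormula.sequentiallyBounded UnbddSet.omegaName.{u} UnbddSet.genericName.{u}) ∧
    -- `T ⊩` not every sequentially bounded set of natural numbers is bounded
    Forces ⊤ (SetFormula.neg (SetFormula.weakBD UnbddSet.omegaName.{u})) := by
  exact ⟨fun _ _ _ hne => UnbddSet.forces_natName_mem_genericName_iff hne,
    UnbddSet.forces_genericName_sub_omegaName, UnbddSet.forces_unbounded_genericName,
    UnbddSet.forces_sequentiallyBounded_genericName, UnbddSet.forces_neg_weakBD⟩
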